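/- For $\eta>0$ and $0<\phi<\pi/2$ let $\Delta(\phi,\eta)=\{z\in\mathbb C: |z|<1+\eta,\ |\mathrm{Arg}(z-1)|>\phi\}$ (so $1\notin\Delta(\phi,\eta)$, and $\Delta(\phi,\eta)$ contains the open unit disc). A function defined by a Taylor series at $0$ with radius of convergence equal to $1$ is called $\Delta$-regular in $\Delta(\phi,\eta)$ if it continues analytically to $\Delta(\phi,\eta)$; the continuation is denoted by the same letter. The Hadamard product of $f(z)=\sum_{n\ge0} f_nz^n$ and $g(z)=\sum_{n\ge0} g_nz^n$ is $(f\odot g)(z)=\sum_{n\ge0} f_ng_nz^n$. Proposition. Let $0<\psi_0<\pi/2$, $\eta>0$, and let $a,b$ be real numbers with $a+b+1<0$. Suppose that $f$ and $g$ are $\Delta$-regular in $\Delta(\psi_0,\eta)$ and that $$f(z)=O(|1-z|^a)\quad\text{and}\quad g(z)=O(|1-z|^b)\qquad\text{uniformly for } z\in\Delta(\psi_0,\eta).$$ Then there are $\psi_1\in[\psi_0,\pi/2)$ and $\eta_1\in(0,\eta]$ such that $f\odot g$ continues analytically to the (possibly smaller) domain $\Delta'=\Delta(\psi_1,\eta_1)$,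 and the continuation satisfies $$(f\odot g)(z)=O(|1-z|^{a+b+1})\qquad\text{uniformly for } z\in\Delta'.$$ -/

import Mathlib

open Asymptotics Filter

/-- The domain `Δ(φ, η) = {z : |z| < 1 + η, |Arg (z - 1)| > φ}`. The point `z = 1` is excluded
for every `φ ≥ 0`, because `Complex.arg 0 = 0`. -/
def deltaDomain (φ η : ℝ) : Set ℂ :=
  {z : ℂ | ‖z‖ < 1 + η ∧ φ < |Complex.arg (z - 1)|}

/-- The power series `∑ pₙ zⁿ` as a formal multilinear series on `ℂ`. -/
noncomputable def toFormal (p : PowerSeries ℂ) : FormalMultilinearSeries ℂ ℂ ℂ :=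
  FormalMultilinearSeries.ofScalars ℂ (fun n => PowerSeries.coeff n p)

/-- The Hadamard (termwise) product `∑ aₙ bₙ zⁿ` of `∑ aₙ zⁿ` and `∑ bₙ zⁿ`. -/
noncomputable def hadamardProduct (p q : PowerSeries ℂ) : PowerSeries ℂ :=
  PowerSeries.mk fun n => PowerSeries.coeff n p * PowerSeries.coeff n q

/-- `F` is the analytic continuation to `Δ(φ, η)` of the function defined near `0` by the
convergent power series `p`. -/
structure IsDeltaContinuation (p : PowerSeries ℂ) (F : ℂ → ℂ) (φ η : ℝ) : Prop where
  taylor : HasFPowerSeriesAt F (toFormal p) 0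
  analytic : AnalyticOnNhd ℂ F (deltaDomain φ η)

/-- The function defined by the Taylor series `p` is `Δ`-regular in `Δ(φ, η)`, with analytic
continuation `F`: the radius of convergence of `p` is `1`, and `F` continues it to `Δ(φ, η)`. -/
structure IsDeltaRegular (p : PowerSeries ℂ) (F : ℂ → ℂ) (φ η : ℝ) : Prop
    extends IsDeltaContinuation p F φ η where
  radius_eq_one : (toFormal p).radius = 1

/-!
The gauge `‖z‖ * exp (-κ * |arg z|)` satisfies `gauge (z / w) ≤ gauge z / gauge w`, because
`|arg|` is subadditive. Hence if `v` runs over the level curve `gauge v = ρ`, a pair of logarithmic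
spirals, and `gauge z < ρ < 1`, then both `v` and `z / v` have gauge less than `1`, and the
Hadamard integral `(2πi)⁻¹ ∮ F(v) G(z / v) dv / v` continues the Hadamard product to
`{gauge < 1}`; different choices of `ρ` agree by the identity theorem.

Put `r = ‖1 - z‖` and let `z` range over the domain of a smaller `κ`, where the gauge of `z` is at
most `1 - 2 c r`. On the curve with `ρ = 1 - c r`, at the point of argument `α`, both `‖1 - v‖` and
`‖1 - z / v‖` are comparable to `r + |α|`, so that the integral is
`O(∫ (r + |α|) ^ (a + b) dα) = O(r ^ (a + b + 1))`.

Near `1` the boundary spirals leave the real axis at a positive angle less than `π / 2`, so that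
spiral domains and `Δ`-domains can be nested in each other in either order.
-/

section Spiral

open Complex Real Set Topology
open scoped Interval

lemma abs_arg_exp {t : ℂ} (ht : |t.im| ≤ π) : |(exp t).arg| = |t.im| := by
  rcases (neg_le_of_abs_le ht).eq_or_lt with h | h
  · have hexp : exp t = ((-Real.exp t.re : ℝ) : ℂ) := by
      rw [← re_add_im t, ← h, Complex.exp_add]
      simp [Complex.exp_neg, ofReal_exp]
    rw [hexp, arg_ofReal_of_neg (by simpa using Real.exp_pos _), ← h, abs_neg]
  · rw [arg_exp, (toIocMod_eq_self _).2 ⟨h, by linarith [le_of_abs_le ht]⟩]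

lemma abs_arg_mul_le (z w : ℂ) : |(z * w).arg| ≤ |z.arg| + |w.arg| := by
  rcases eq_or_ne z 0 with rfl | hz
  · simp
  rcases eq_or_ne w 0 with rfl | hw
  · simp
  have h := InnerProductGeometry.angle_le_angle_add_angle 1 z (z * w)
  rwa [angle_one_left (mul_ne_zero hz hw), angle_one_left hz, angle_eq_abs_arg hz (by simp [*]),
    div_mul_cancel_left₀ hz, abs_arg_inv] at h

lemma abs_sin_arg_le_norm_one_sub (u : ℂ) : |Real.sin u.arg| ≤ ‖1 - u‖ := by
  have hu : exp (-(u.arg * I)) * u = ‖u‖ := by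
    conv_lhs => rw [← norm_mul_exp_arg_mul_I u, mul_left_comm, ← Complex.exp_add]
    simp
  calc |Real.sin u.arg| = |(exp (-(u.arg * I)) * (1 - u)).im| := by
        rw [mul_sub, hu]
        simp [Complex.exp_im]
    _ ≤ ‖exp (-(u.arg * I)) * (1 - u)‖ := abs_im_le_norm _
    _ = ‖1 - u‖ := by
        rw [norm_mul, ← neg_mul, ← ofReal_neg, norm_exp_ofReal_mul_I, one_mul]

lemma abs_arg_le_pi_mul_norm_one_sub (u : ℂ) : |u.arg| ≤ π * ‖1 - u‖ := by
  have hpi := pi_pos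
  rcases le_total |u.arg| (π / 2) with h | h
  · have hsin := (mul_abs_le_abs_sin h).trans (abs_sin_arg_le_norm_one_sub u)
    rw [div_mul_eq_mul_div, div_le_iff₀ hpi] at hsin
    nlinarith [norm_nonneg (1 - u)]
  · have hre : u.re ≤ 0 := by
      by_contra! hpos
      exact h.not_gt (abs_arg_lt_pi_div_two_iff.2 (.inl hpos))
    have hone : 1 ≤ ‖1 - u‖ :=
      ((le_sub_self_iff 1).2 hre).trans (by simpa using re_le_norm (1 - u))
    exact (abs_arg_le_pi u).trans (le_mul_of_one_le_right hpi.le hone)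

lemma norm_mul_abs_arg_le_pi_mul_norm_one_sub (u : ℂ) : ‖u‖ * |u.arg| ≤ π * ‖1 - u‖ := by
  rcases eq_or_ne u 0 with rfl | hu
  · simp [pi_pos.le]
  calc ‖u‖ * |u.arg| ≤ ‖u‖ * (π * ‖1 - u⁻¹‖) := by
        rw [← abs_arg_inv]
        gcongr
        exact abs_arg_le_pi_mul_norm_one_sub _
    _ = π * ‖1 - u‖ := by
        rw [mul_left_comm, ← norm_mul, mul_sub, mul_one, mul_inv_cancel₀ hu, norm_sub_rev]

lemma exp_sub_one_le_mul_exp (x : ℝ) : Real.exp x - 1 ≤ x * Real.exp x := by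
  have h := mul_le_mul_of_nonneg_right (one_sub_le_exp_neg x) (Real.exp_pos x).le
  rw [← Real.exp_add, neg_add_cancel, Real.exp_zero] at h
  linarith

lemma norm_one_sub_exp_ofReal_mul_I_le (θ : ℝ) : ‖1 - exp (θ * I)‖ ≤ |θ| := by
  rw [norm_sub_rev, mul_comm]
  exact norm_exp_I_mul_ofReal_sub_one_le

/-- The gauge of the region bounded by the pair of logarithmic spirals
`‖z‖ = exp (κ * |arg z|)`; the value at `0` is `0`. -/
noncomputable def spiralGauge (κ : ℝ) (z : ℂ) : ℝ :=
  ‖z‖ * Real.exp (-(κ * |z.arg|))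

/-- The region inside the logarithmic spirals issuing from the point `ρ` of the real axis. -/
def spiralDomain (κ ρ : ℝ) : Set ℂ :=
  {z | spiralGauge κ z < ρ}

/-- The closed curve formed by the logarithmic spirals issuing from `1`, parametrized by the
argument in `[-π, π]`. -/
noncomputable def spiralCurve (κ α : ℝ) : ℂ :=
  exp ((κ * |α| : ℝ) + α * I)

section Gauge

variable {κ κ' ρ : ℝ} {z : ℂ}

@[simp] lemma spiralGauge_zero : spiralGauge κ 0 = 0 := by simp [spiralGauge]

@[simp] lemma spiralGauge_one : spiralGauge κ 1 = 1 := by simp [spiralGauge]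

lemma spiralGauge_nonneg : 0 ≤ spiralGauge κ z := by unfold spiralGauge; positivity

lemma spiralGauge_ofReal_mul {t : ℝ} (ht : 0 ≤ t) :
    spiralGauge κ (t * z) = t * spiralGauge κ z := by
  rcases ht.eq_or_lt with rfl | ht
  · simp
  · simp [spiralGauge, arg_real_mul _ ht, abs_of_pos ht, mul_assoc]

lemma spiralGauge_eq_mul_exp (κ κ' : ℝ) (z : ℂ) :
    spiralGauge κ z = spiralGauge κ' z * Real.exp (-((κ - κ') * |z.arg|)) := by
  rw [spiralGauge, spiralGauge, mul_assoc, ← Real.exp_add]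
  ring_nf

lemma spiralGauge_le_of_le (h : κ' ≤ κ) : spiralGauge κ z ≤ spiralGauge κ' z := by
  unfold spiralGauge
  gcongr

lemma spiralGauge_mul_le (hκ : 0 ≤ κ) (z w : ℂ) :
    spiralGauge κ (z * w) ≤ spiralGauge κ z * spiralGauge (-κ) w := by
  rcases eq_or_ne w 0 with rfl | hw
  · simp
  have harg : |z.arg| ≤ |(z * w).arg| + |w.arg| := by
    simpa [hw] using abs_arg_mul_le (z * w) w⁻¹
  simp only [spiralGauge, norm_mul]
  rw [mul_mul_mul_comm, ← Real.exp_add]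
  gcongr
  nlinarith

lemma spiralGauge_neg_inv : spiralGauge (-κ) z⁻¹ = (spiralGauge κ z)⁻¹ := by
  simp [spiralGauge, Real.exp_neg, mul_comm]

lemma spiralGauge_mul_inv_le (hκ : 0 ≤ κ) (z w : ℂ) :
    spiralGauge κ (z * w⁻¹) ≤ spiralGauge κ z / spiralGauge κ w := by
  simpa only [spiralGauge_neg_inv, div_eq_mul_inv] using spiralGauge_mul_le hκ z w⁻¹

lemma continuousAt_abs_arg (hz : z ≠ 0) : ContinuousAt (fun w : ℂ ↦ |w.arg|) z := by
  have hangle : ContinuousAt (fun w : ℂ ↦ InnerProductGeometry.angle (1 : ℂ) w) z :=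
    (InnerProductGeometry.continuousAt_angle (x := ((1 : ℂ), z)) one_ne_zero hz).comp
      (f := fun w : ℂ ↦ ((1 : ℂ), w)) (by fun_prop)
  refine hangle.congr ?_
  filter_upwards [isOpen_ne.mem_nhds hz] with w hw using angle_one_left hw

lemma continuous_spiralGauge : Continuous (spiralGauge κ) := by
  refine continuous_iff_continuousAt.2 fun z ↦ ?_
  rcases eq_or_ne z 0 with rfl | hz
  · rw [ContinuousAt, spiralGauge_zero]
    refine squeeze_zero (g := fun w ↦ ‖w‖ * Real.exp (|κ| * π)) (fun _ ↦ spiralGauge_nonneg)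
      (fun w ↦ ?_) ?_
    · have hκw : -(κ * |w.arg|) ≤ |κ| * π :=
        (neg_le_abs _).trans (by rw [abs_mul, abs_abs]; gcongr; exact abs_arg_le_pi w)
      unfold spiralGauge
      gcongr
    · exact (continuous_norm.mul_const _).tendsto' 0 0 (by simp)
  · exact continuous_norm.continuousAt.mul
      (Real.continuous_exp.continuousAt.comp ((continuousAt_abs_arg hz).const_mul κ).neg)

lemma isOpen_spiralDomain : IsOpen (spiralDomain κ ρ) :=
  isOpen_lt continuous_spiralGauge continuous_const

lemma zero_mem_spiralDomain (hρ : 0 < ρ) : (0 : ℂ) ∈ spiralDomain κ ρ := by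
  simpa [spiralDomain] using hρ

lemma spiralDomain_subset {ρ' : ℝ} (hκ : κ' ≤ κ) (hρ : ρ ≤ ρ') :
    spiralDomain κ' ρ ⊆ spiralDomain κ ρ' := fun _ hz ↦
  ((spiralGauge_le_of_le hκ).trans_lt hz).trans_le hρ

lemma isPreconnected_spiralDomain : IsPreconnected (spiralDomain κ ρ) := by
  rcases (spiralDomain κ ρ).eq_empty_or_nonempty with h | ⟨z, hz⟩
  · exact h ▸ isPreconnected_empty
  have hρ : 0 < ρ := spiralGauge_nonneg.trans_lt hz
  have hstar : StarConvex ℝ 0 (spiralDomain κ ρ) := by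
    refine starConvex_zero_iff.2 fun w hw t ht0 ht1 ↦ ?_
    change spiralGauge κ (t • w) < ρ
    rw [real_smul, spiralGauge_ofReal_mul ht0]
    exact (mul_le_of_le_one_left spiralGauge_nonneg ht1).trans_lt hw
  exact (hstar.isPathConnected (zero_mem_spiralDomain hρ)).isConnected.isPreconnected

lemma continuous_spiralCurve : Continuous (spiralCurve κ) := by
  unfold spiralCurve
  fun_prop

lemma spiralCurve_ne_zero (α : ℝ) : spiralCurve κ α ≠ 0 := exp_ne_zero _

lemma abs_arg_spiralCurve {α : ℝ} (hα : |α| ≤ π) : |(spiralCurve κ α).arg| = |α| := by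
  simpa [spiralCurve] using abs_arg_exp (t := (κ * |α| : ℝ) + α * I) (by simpa using hα)

lemma spiralGauge_spiralCurve {α : ℝ} (hα : |α| ≤ π) : spiralGauge κ (spiralCurve κ α) = 1 := by
  rw [spiralGauge, abs_arg_spiralCurve hα, spiralCurve, norm_exp, ← Real.exp_add]
  simp

lemma spiralGauge_mul_spiralCurve_arg (z : ℂ) : spiralGauge κ z * spiralCurve κ z.arg = z := by
  rw [spiralGauge, spiralCurve, Complex.exp_add, ← ofReal_exp, ← mul_assoc, ← ofReal_mul, mul_assoc,
    ← Real.exp_add, neg_add_cancel, Real.exp_zero, mul_one, norm_mul_exp_arg_mul_I]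

end Gauge

section Estimates

variable {κ κ' : ℝ}

lemma one_sub_spiralGauge_le (hκ : 0 ≤ κ) (u : ℂ) :
    1 - spiralGauge κ u ≤ (1 + κ * π) * ‖1 - u‖ := by
  have hexp : ‖u‖ * (1 - κ * |u.arg|) ≤ spiralGauge κ u :=
    mul_le_mul_of_nonneg_left (one_sub_le_exp_neg _) (norm_nonneg u)
  have hnorm : 1 - ‖u‖ ≤ ‖1 - u‖ := by simpa using norm_sub_norm_le 1 u
  linear_combination hexp + hnorm + κ * norm_mul_abs_arg_le_pi_mul_norm_one_sub u

lemma norm_one_sub_ofReal_mul_spiralCurve_le (hκ : 0 ≤ κ) {t α : ℝ} (ht₀ : 0 ≤ t) (ht₁ : t ≤ 1)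
    (hα : |α| ≤ π) :
    ‖1 - t * spiralCurve κ α‖ ≤ (1 - t) + t * ((1 + κ) * Real.exp (κ * π) * |α|) := by
  have hexp : Real.exp (κ * |α|) ≤ Real.exp (κ * π) := by gcongr
  have hcurve : ‖1 - spiralCurve κ α‖ ≤ (1 + κ) * Real.exp (κ * π) * |α| := by
    have hsplit : 1 - spiralCurve κ α =
        Real.exp (κ * |α|) * (1 - exp (α * I)) - (Real.exp (κ * |α|) - 1 : ℝ) := by
      rw [spiralCurve, Complex.exp_add, ← ofReal_exp]
      push_cast
      ring
    calc ‖1 - spiralCurve κ α‖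
        ≤ Real.exp (κ * |α|) * ‖1 - exp (α * I)‖ + (Real.exp (κ * |α|) - 1) := by
          rw [hsplit]
          refine (norm_sub_le _ _).trans_eq ?_
          rw [norm_mul, norm_real, norm_real, Real.norm_of_nonneg (Real.exp_pos _).le,
            Real.norm_of_nonneg (sub_nonneg.2 (Real.one_le_exp (by positivity)))]
      _ ≤ Real.exp (κ * |α|) * |α| + κ * |α| * Real.exp (κ * |α|) := by
          gcongr
          · exact norm_one_sub_exp_ofReal_mul_I_le α
          · exact exp_sub_one_le_mul_exp _
      _ = (1 + κ) * Real.exp (κ * |α|) * |α| := by ring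
      _ ≤ (1 + κ) * Real.exp (κ * π) * |α| := by gcongr
  calc ‖1 - t * spiralCurve κ α‖ = ‖((1 - t : ℝ) : ℂ) + t * (1 - spiralCurve κ α)‖ := by
        push_cast
        ring_nf
    _ ≤ (1 - t) + t * ‖1 - spiralCurve κ α‖ := by
        refine (norm_add_le _ _).trans_eq ?_
        rw [norm_mul, norm_real, norm_real, Real.norm_of_nonneg ht₀,
          Real.norm_of_nonneg (sub_nonneg.2 ht₁)]
    _ ≤ _ := by gcongr

lemma exists_spiralGauge_le_one_sub (hκ' : 0 ≤ κ') (h : κ' < κ) :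
    ∃ c > 0, ∀ z ∈ spiralDomain κ' 1, spiralGauge κ z ≤ 1 - c * ‖1 - z‖ := by
  set δ := (κ - κ') * Real.exp (-((κ - κ') * π)) with hδ
  set C := (1 + κ') * Real.exp (κ' * π)
  have hδ₀ : 0 < δ := mul_pos (sub_pos.2 h) (Real.exp_pos _)
  have hC₀ : 0 < C := by positivity
  refine ⟨min 1 (δ / C), lt_min one_pos (div_pos hδ₀ hC₀), fun z hz ↦ ?_⟩
  set t := spiralGauge κ' z
  set c := min 1 (δ / C)
  have ht₀ : 0 ≤ t := spiralGauge_nonneg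
  have ht₁ : t < 1 := hz
  have hupper : ‖1 - z‖ ≤ (1 - t) + t * (C * |z.arg|) := by
    conv_lhs => rw [← spiralGauge_mul_spiralCurve_arg (κ := κ') z]
    exact norm_one_sub_ofReal_mul_spiralCurve_le hκ' ht₀ ht₁.le (abs_arg_le_pi z)
  have hlower : Real.exp (-((κ - κ') * |z.arg|)) ≤ 1 - δ * |z.arg| := by
    have hneg := exp_sub_one_le_mul_exp (-((κ - κ') * |z.arg|))
    have hmono : Real.exp (-((κ - κ') * π)) ≤ Real.exp (-((κ - κ') * |z.arg|)) := by
      gcongr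
      exact abs_arg_le_pi z
    rw [hδ]
    have : 0 ≤ (κ - κ') * |z.arg| := mul_nonneg (sub_pos.2 h).le (abs_nonneg _)
    nlinarith
  have hc₁ : c ≤ 1 := min_le_left _ _
  have hcC : c * C ≤ δ := (le_div_iff₀ hC₀).1 (min_le_right _ _)
  calc spiralGauge κ z ≤ t * (1 - δ * |z.arg|) := by
        rw [spiralGauge_eq_mul_exp κ κ']
        gcongr
    _ ≤ t * (1 - c * C * |z.arg|) := by gcongr
    _ ≤ 1 - c * ((1 - t) + t * (C * |z.arg|)) := by nlinarith
    _ ≤ 1 - c * ‖1 - z‖ := by gcongr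

lemma add_abs_arg_le_of_spiralGauge_le_one_sub (hκ : 0 ≤ κ) {ε : ℝ} {u : ℂ}
    (hu : spiralGauge κ u ≤ 1 - ε) : ε + |u.arg| ≤ (1 + κ * π + π) * ‖1 - u‖ := by
  linarith [one_sub_spiralGauge_le hκ u, abs_arg_le_pi_mul_norm_one_sub u]

end Estimates

section Inclusions

variable {κ ψ η : ℝ}

lemma one_le_spiralGauge_of_abs_arg_sub_one_le (hκ : 0 ≤ κ) (hψ : ψ ≤ π)
    (hκψ : κ * π ≤ Real.cos ψ) {z : ℂ} (hz : |(z - 1).arg| ≤ ψ) : 1 ≤ spiralGauge κ z := by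
  have hnorm : ‖1 - z‖ * Real.cos ψ ≤ ‖z‖ - 1 := by
    have hcos : Real.cos ψ ≤ Real.cos (z - 1).arg := by
      rw [← Real.cos_abs (z - 1).arg]
      exact cos_le_cos_of_nonneg_of_le_pi (abs_nonneg _) hψ hz
    calc ‖1 - z‖ * Real.cos ψ ≤ ‖z - 1‖ * Real.cos (z - 1).arg := by
          rw [norm_sub_rev]
          gcongr
      _ = z.re - 1 := by simp [norm_mul_cos_arg]
      _ ≤ ‖z‖ - 1 := by gcongr; exact re_le_norm z
  have hturn : κ * (‖z‖ * |z.arg|) ≤ ‖1 - z‖ * Real.cos ψ :=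
    calc κ * (‖z‖ * |z.arg|) ≤ κ * (π * ‖1 - z‖) :=
          mul_le_mul_of_nonneg_left (norm_mul_abs_arg_le_pi_mul_norm_one_sub z) hκ
      _ = ‖1 - z‖ * (κ * π) := by ring
      _ ≤ ‖1 - z‖ * Real.cos ψ := by gcongr
  have hexp : ‖z‖ * (1 - κ * |z.arg|) ≤ spiralGauge κ z :=
    mul_le_mul_of_nonneg_left (one_sub_le_exp_neg _) (norm_nonneg z)
  linarith

lemma norm_le_spiralGauge_mul_exp (hκ : 0 ≤ κ) (z : ℂ) :
    ‖z‖ ≤ spiralGauge κ z * Real.exp (κ * π) := by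
  calc ‖z‖ = spiralGauge κ z * Real.exp (κ * |z.arg|) := by
        simp [spiralGauge, mul_assoc, ← Real.exp_add]
    _ ≤ spiralGauge κ z * Real.exp (κ * π) := by
        refine mul_le_mul_of_nonneg_left ?_ spiralGauge_nonneg
        gcongr
        exact abs_arg_le_pi z

lemma exists_spiralDomain_subset_deltaDomain (hψ₀ : 0 ≤ ψ) (hψ : ψ < π / 2) (hη : 0 < η) :
    ∃ κ > 0, spiralDomain κ 1 ⊆ deltaDomain ψ η := by
  have hcos : 0 < Real.cos ψ := cos_pos_of_mem_Ioo ⟨by linarith [pi_pos], hψ⟩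
  have hlog : 0 < Real.log (1 + η) := log_pos (by linarith)
  set κ := min (Real.cos ψ) (Real.log (1 + η)) / π
  have hκ : 0 < κ := div_pos (lt_min hcos hlog) pi_pos
  have hκπ : κ * π = min (Real.cos ψ) (Real.log (1 + η)) := div_mul_cancel₀ _ pi_ne_zero
  refine ⟨κ, hκ, fun z (hz : spiralGauge κ z < 1) ↦ ⟨?_, ?_⟩⟩
  · calc ‖z‖ ≤ spiralGauge κ z * Real.exp (κ * π) := norm_le_spiralGauge_mul_exp hκ.le z
      _ < 1 * Real.exp (κ * π) := by gcongr
      _ ≤ 1 + η := by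
          rw [one_mul, ← Real.le_log_iff_exp_le (by linarith), hκπ]
          exact min_le_right _ _
  · by_contra! harg
    exact hz.not_ge <| one_le_spiralGauge_of_abs_arg_sub_one_le hκ.le (by linarith [pi_pos])
      (hκπ.trans_le (min_le_left _ _)) harg

lemma abs_arg_le_arccos_of_mul_norm_le_re {q : ℝ} {u : ℂ} (hu : u ≠ 0) (h : q * ‖u‖ ≤ u.re) :
    |u.arg| ≤ Real.arccos q := by
  have hq : q ≤ Real.cos u.arg := by
    rw [cos_arg hu]
    exact (le_div_iff₀ (norm_pos_iff.2 hu)).2 h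
  calc |u.arg| = Real.arccos (Real.cos |u.arg|) :=
        (arccos_cos (abs_nonneg _) (abs_arg_le_pi u)).symm
    _ ≤ Real.arccos q := arccos_le_arccos (by rwa [Real.cos_abs])

lemma norm_sub_one_le_add_norm_mul_abs_arg (z : ℂ) (hz : 1 ≤ ‖z‖) :
    ‖z - 1‖ ≤ (‖z‖ - 1) + ‖z‖ * |z.arg| := by
  have hsplit : z - 1 = ((‖z‖ - 1 : ℝ) : ℂ) - ‖z‖ * (1 - exp (z.arg * I)) := by
    conv_lhs => rw [← norm_mul_exp_arg_mul_I z]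
    push_cast
    ring
  calc ‖z - 1‖ ≤ ‖((‖z‖ - 1 : ℝ) : ℂ)‖ + ‖(‖z‖ : ℂ) * (1 - exp (z.arg * I))‖ := by
        conv_lhs => rw [hsplit]
        exact norm_sub_le _ _
    _ = (‖z‖ - 1) + ‖z‖ * ‖1 - exp (z.arg * I)‖ := by
        rw [norm_mul, norm_real, norm_real, norm_norm, Real.norm_of_nonneg (sub_nonneg.2 hz)]
    _ ≤ (‖z‖ - 1) + ‖z‖ * |z.arg| := by
        gcongr
        exact norm_one_sub_exp_ofReal_mul_I_le _

lemma mul_norm_sub_one_le_re_sub_one_of_one_le_spiralGauge (hκ : 0 < κ) {z : ℂ}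
    (hz : 1 ≤ spiralGauge κ z) (hz₁ : ‖z‖ ≤ 1 + min 1 (κ ^ 2 / 2)) :
    κ / (2 * κ + 4) * ‖z - 1‖ ≤ (z - 1).re := by
  set x := ‖z‖ - 1
  have hx₁ : x ≤ 1 := by linarith [min_le_left 1 (κ ^ 2 / 2)]
  have hx₂ : x ≤ κ ^ 2 / 2 := by linarith [min_le_right 1 (κ ^ 2 / 2)]
  have hturn : κ * |z.arg| ≤ x := by
    have hexp : Real.exp (κ * |z.arg|) ≤ ‖z‖ := by
      rwa [spiralGauge, Real.exp_neg, ← div_eq_mul_inv, one_le_div (Real.exp_pos _)] at hz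
    linarith [Real.add_one_le_exp (κ * |z.arg|)]
  have hx₀ : 0 ≤ x := (by positivity : 0 ≤ κ * |z.arg|).trans hturn
  have hsq : z.arg ^ 2 ≤ x / 2 := by
    have hmul : κ ^ 2 * |z.arg| ^ 2 ≤ κ ^ 2 * (x / 2) :=
      calc κ ^ 2 * |z.arg| ^ 2 = (κ * |z.arg|) ^ 2 := by ring
        _ ≤ x ^ 2 := by gcongr
        _ ≤ κ ^ 2 * (x / 2) := by nlinarith
    rw [← sq_abs]
    exact le_of_mul_le_mul_left hmul (by positivity)
  have hre : x / 2 ≤ (z - 1).re := by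
    have hcos : ‖z‖ * (1 - z.arg ^ 2 / 2) ≤ z.re := by
      rw [← norm_mul_cos_arg z]
      gcongr
      exact one_sub_sq_div_two_le_cos
    rw [sub_re, one_re]
    nlinarith
  have hnorm : κ * ‖z - 1‖ ≤ (κ + 2) * x := by
    have := norm_sub_one_le_add_norm_mul_abs_arg z (sub_nonneg.1 hx₀)
    nlinarith [abs_nonneg z.arg]
  calc κ / (2 * κ + 4) * ‖z - 1‖ = κ * ‖z - 1‖ / (2 * κ + 4) := by ring
    _ ≤ x / 2 := by
        rw [div_le_iff₀ (by positivity)]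
        linarith
    _ ≤ (z - 1).re := hre

lemma exists_deltaDomain_subset_spiralDomain (hκ : 0 < κ) (hψ : ψ < π / 2) (hη : 0 < η) :
    ∃ ψ₁ η₁ : ℝ, ψ ≤ ψ₁ ∧ ψ₁ < π / 2 ∧ 0 < η₁ ∧ η₁ ≤ η ∧
      deltaDomain ψ₁ η₁ ⊆ spiralDomain κ 1 := by
  refine ⟨max ψ (Real.arccos (κ / (2 * κ + 4))), min η (min 1 (κ ^ 2 / 2)), le_max_left _ _,
    max_lt hψ (arccos_lt_pi_div_two.2 (by positivity)), by positivity, min_le_left _ _, ?_⟩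
  rintro z ⟨hnorm, harg⟩
  have harg' : Real.arccos (κ / (2 * κ + 4)) < |(z - 1).arg| := (le_max_right _ _).trans_lt harg
  have hz : z - 1 ≠ 0 := by
    rintro h
    rw [h, arg_zero, abs_zero] at harg'
    exact harg'.not_ge (arccos_nonneg _)
  by_contra hgauge
  exact harg'.not_ge <| abs_arg_le_arccos_of_mul_norm_le_re hz <|
    mul_norm_sub_one_le_re_sub_one_of_one_le_spiralGauge hκ (not_lt.1 hgauge)
      (by linarith [min_le_right η (min 1 (κ ^ 2 / 2))])

end Inclusions

section ParametricIntegral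

open MeasureTheory

variable {a b : ℝ} {c u : ℝ → ℂ} {G : ℂ → ℂ} {g : PowerSeries ℂ}

lemma differentiableOn_intervalIntegral_mul {Ω V : Set ℂ} (hc : IntervalIntegrable c volume a b)
    (hu : ContinuousOn u [[a, b]]) (hΩ : IsOpen Ω) (hG : DifferentiableOn ℂ G Ω) (hV : IsOpen V)
    (hVΩ : ∀ z ∈ V, ∀ t ∈ [[a, b]], z * u t ∈ Ω) :
    DifferentiableOn ℂ (fun z ↦ ∫ t in a..b, c t * G (z * u t)) V := by
  intro z₀ hz₀
  obtain ⟨ε, hε, hεV⟩ := Metric.nhds_basis_closedBall.mem_iff.1 (hV.mem_nhds hz₀)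
  have hslice {H : ℂ → ℂ} (hH : ContinuousOn H Ω) {z : ℂ} (hz : z ∈ V) :
      ContinuousOn (fun t ↦ H (z * u t)) [[a, b]] :=
    hH.comp (hu.const_mul z) fun t ht ↦ hVΩ z hz t ht
  have hderiv : ContinuousOn (deriv G) Ω := (hG.deriv hΩ).continuousOn
  obtain ⟨M, hM⟩ : ∃ M, ∀ p ∈ Metric.closedBall z₀ ε ×ˢ [[a, b]],
      ‖u p.2 * deriv G (p.1 * u p.2)‖ ≤ M := by
    have hu₂ : ContinuousOn (fun p : ℂ × ℝ ↦ u p.2) (Metric.closedBall z₀ ε ×ˢ [[a, b]]) :=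
      hu.comp continuousOn_snd fun p hp ↦ hp.2
    exact ((isCompact_closedBall z₀ ε).prod isCompact_uIcc).exists_bound_of_continuousOn
      (hu₂.mul (hderiv.comp (continuousOn_fst.mul hu₂) fun p hp ↦ hVΩ _ (hεV hp.1) _ hp.2))
  have hmeas : ∀ z ∈ V, IntervalIntegrable (fun t ↦ c t * G (z * u t)) volume a b :=
    fun z hz ↦ hc.mul_continuousOn (hslice hG.continuousOn hz)
  have hbound : ∀ t ∈ Ι a b, ∀ z ∈ Metric.closedBall z₀ ε,
      ‖c t * (u t * deriv G (z * u t))‖ ≤ ‖c t‖ * M := fun t ht z hz ↦ by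
    rw [norm_mul]
    exact mul_le_mul_of_nonneg_left (hM (z, t) ⟨hz, uIoc_subset_uIcc ht⟩) (norm_nonneg _)
  have hdiff : ∀ t ∈ Ι a b, ∀ z ∈ Metric.closedBall z₀ ε,
      HasDerivAt (fun z ↦ c t * G (z * u t)) (c t * (u t * deriv G (z * u t))) z :=
    fun t ht z hz ↦ by
      have hGz := (hG.differentiableAt
        (hΩ.mem_nhds (hVΩ z (hεV hz) t (uIoc_subset_uIcc ht)))).hasDerivAt
      rw [mul_comm (u t)]
      exact (hGz.comp z (hasDerivAt_mul_const (u t))).const_mul (c t)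
  exact (intervalIntegral.hasDerivAt_integral_of_dominated_loc_of_deriv_le
    (Metric.closedBall_mem_nhds z₀ hε)
    ((hV.eventually_mem hz₀).mono fun z hz ↦ (hmeas z hz).def'.aestronglyMeasurable)
    (hmeas z₀ hz₀)
    (hc.mul_continuousOn (hu.mul (hslice hderiv hz₀))).def'.aestronglyMeasurable
    (ae_of_all _ hbound) (hc.norm.mul_const M)
    (ae_of_all _ hdiff)).2.differentiableAt.differentiableWithinAt

lemma hasFPowerSeriesAt_toFormal_iff :
    HasFPowerSeriesAt G (toFormal g) 0 ↔
      ∀ᶠ z in 𝓝 0, HasSum (fun n ↦ PowerSeries.coeff n g * z ^ n) (G z) := by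
  simp [hasFPowerSeriesAt_iff, toFormal, FormalMultilinearSeries.coeff_ofScalars, mul_comm]

lemma exists_summable_norm_coeff_mul_pow (hG : HasFPowerSeriesAt G (toFormal g) 0) :
    ∃ r : ℝ, 0 < r ∧ Summable (fun n ↦ ‖PowerSeries.coeff n g‖ * r ^ n) ∧
      ∀ z, ‖z‖ ≤ r → HasSum (fun n ↦ PowerSeries.coeff n g * z ^ n) (G z) := by
  obtain ⟨r, hr, hrG⟩ :=
    Metric.nhds_basis_closedBall.mem_iff.1 (hasFPowerSeriesAt_toFormal_iff.1 hG)
  have hsum : ∀ z, ‖z‖ ≤ r → HasSum (fun n ↦ PowerSeries.coeff n g * z ^ n) (G z) :=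
    fun z hz ↦ hrG (mem_closedBall_zero_iff.2 hz)
  refine ⟨r, hr, ?_, hsum⟩
  simpa [abs_of_pos hr] using (hsum r (by simp [abs_of_pos hr])).summable.norm

lemma hasFPowerSeriesAt_intervalIntegral_mul (hc : IntervalIntegrable c volume a b)
    (hu : ContinuousOn u [[a, b]]) (hG : HasFPowerSeriesAt G (toFormal g) 0) :
    HasFPowerSeriesAt (fun z ↦ ∫ t in a..b, c t * G (z * u t))
      (toFormal (PowerSeries.mk fun n ↦ PowerSeries.coeff n g * ∫ t in a..b, c t * u t ^ n)) 0 := by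
  obtain ⟨r, hr, hsummable, hsum⟩ := exists_summable_norm_coeff_mul_pow hG
  obtain ⟨B, hB⟩ := isCompact_uIcc.exists_bound_of_continuousOn hu
  have hsmall : ∀ᶠ z : ℂ in 𝓝 0, ‖z‖ * B ≤ r := by
    have : Tendsto (fun z : ℂ ↦ ‖z‖ * B) (𝓝 0) (𝓝 0) :=
      (continuous_norm.mul_const B).tendsto' 0 0 (by simp)
    exact (this.eventually_lt_const hr).mono fun z hz ↦ hz.le
  rw [hasFPowerSeriesAt_toFormal_iff]
  filter_upwards [hsmall] with z hz
  have hzu : ∀ t ∈ Ι a b, ‖z * u t‖ ≤ r := fun t ht ↦ by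
    rw [norm_mul]
    exact (mul_le_mul_of_nonneg_left (hB t (uIoc_subset_uIcc ht)) (norm_nonneg z)).trans hz
  have hterm (n : ℕ) : PowerSeries.coeff n (PowerSeries.mk fun n ↦
      PowerSeries.coeff n g * ∫ t in a..b, c t * u t ^ n) * z ^ n =
      ∫ t in a..b, c t * (PowerSeries.coeff n g * (z * u t) ^ n) := by
    rw [PowerSeries.coeff_mk, mul_right_comm, ← intervalIntegral.integral_const_mul]
    congr with t
    ring
  simp only [hterm]
  refine intervalIntegral.hasSum_integral_of_dominated_convergence
    (fun n t ↦ ‖c t‖ * (‖PowerSeries.coeff n g‖ * r ^ n)) (fun n ↦ ?_)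
    (fun n ↦ ae_of_all _ fun t ht ↦ ?_) (ae_of_all _ fun t _ ↦ hsummable.mul_left _) ?_
    (ae_of_all _ fun t ht ↦ (hsum _ (hzu t ht)).mul_left (c t))
  · have hpow : ContinuousOn (fun t ↦ PowerSeries.coeff n g * (z * u t) ^ n) [[a, b]] := by fun_prop
    exact (hc.mul_continuousOn hpow).def'.aestronglyMeasurable
  · rw [norm_mul, norm_mul, norm_pow]
    gcongr
    exact hzu t ht
  · simp only [tsum_mul_left]
    exact hc.norm.mul_const _

end ParametricIntegral

/-- The density of `dw / (2πiw)` with respect to the parameter of `spiralCurve κ`. -/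
noncomputable def spiralWeight (κ α : ℝ) : ℂ :=
  (1 - (κ * (SignType.sign α : ℝ) : ℝ) * I) / (2 * π)

/-- The contour integral `(2πi)⁻¹ ∮ Φ(w) dw / w` over the closed curve `spiralCurve κ`. -/
noncomputable def spiralMean (κ : ℝ) (Φ : ℂ → ℂ) : ℂ :=
  ∫ α in -π..π, spiralWeight κ α * Φ (spiralCurve κ α)

section SpiralMean

open MeasureTheory

variable {κ : ℝ} {c u Φ Ψ G : ℂ → ℂ} {g : PowerSeries ℂ}

lemma abs_le_pi_of_mem_uIcc {α : ℝ} (hα : α ∈ [[-π, π]]) : |α| ≤ π :=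
  abs_le.2 (by rwa [uIcc_of_le (by linarith [pi_pos])] at hα)

lemma intervalIntegrable_spiralWeight (κ a b : ℝ) :
    IntervalIntegrable (spiralWeight κ) volume a b := by
  have hsign : IntervalIntegrable (fun α : ℝ ↦ (SignType.sign α : ℝ)) volume a b :=
    Monotone.intervalIntegrable fun x y hxy ↦ by
      have h := SignType.sign.monotone hxy
      revert h
      cases SignType.sign x <;> cases SignType.sign y <;> simp
  have hofReal :
      IntervalIntegrable (fun α : ℝ ↦ ((κ * (SignType.sign α : ℝ) : ℝ) : ℂ)) volume a b :=
    ⟨(hsign.const_mul κ).1.ofReal, (hsign.const_mul κ).2.ofReal⟩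
  exact (intervalIntegrable_const.sub (hofReal.mul_const I)).div_const _

lemma norm_spiralWeight_le (hκ : 0 ≤ κ) (α : ℝ) : ‖spiralWeight κ α‖ ≤ (1 + κ) / (2 * π) := by
  have hsign : |(SignType.sign α : ℝ)| ≤ 1 := by cases SignType.sign α <;> simp
  calc ‖spiralWeight κ α‖ = ‖(1 : ℂ) - (κ * (SignType.sign α : ℝ) : ℝ) * I‖ / (2 * π) := by
        simp [spiralWeight, abs_of_pos pi_pos]
    _ ≤ (1 + κ * |(SignType.sign α : ℝ)|) / (2 * π) := by
        gcongr
        refine (norm_sub_le _ _).trans_eq ?_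
        simp [abs_of_nonneg hκ]
    _ ≤ (1 + κ) / (2 * π) := by
        gcongr
        exact mul_le_of_le_one_right hκ hsign

lemma spiralMean_congr (h : ∀ w, spiralGauge κ w = 1 → Φ w = Ψ w) :
    spiralMean κ Φ = spiralMean κ Ψ := by
  refine intervalIntegral.integral_congr fun α hα ↦ ?_
  simp only [h _ (spiralGauge_spiralCurve (abs_le_pi_of_mem_uIcc hα))]

lemma spiralMean_const_mul (a : ℂ) : spiralMean κ (fun w ↦ a * Φ w) = a * spiralMean κ Φ := by
  simp only [spiralMean, mul_left_comm _ a, intervalIntegral.integral_const_mul]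

lemma integral_spiralWeight_mul_deriv {Ψ' : ℂ → ℂ} (hΨ : ∀ t, HasDerivAt Ψ (Ψ' t) t)
    (hΨ' : Continuous Ψ') :
    ∫ α in -π..π, spiralWeight κ α * Ψ' ((κ * |α| : ℝ) + α * I) =
      (Ψ (κ * π + π * I) - Ψ (κ * π - π * I)) / (2 * π * I) := by
  have hcont : Continuous fun α : ℝ ↦ ((κ * |α| : ℝ) : ℂ) + α * I := by fun_prop
  have hderiv : ∀ α ∈ Ioo (min (-π) π) (max (-π) π) \ {0},
      HasDerivAt (fun α : ℝ ↦ Ψ ((κ * |α| : ℝ) + α * I) / (2 * π * I))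
        (spiralWeight κ α * Ψ' ((κ * |α| : ℝ) + α * I)) α := by
    rintro α ⟨-, hα⟩
    have hlog : HasDerivAt (fun α : ℝ ↦ ((κ * |α| : ℝ) : ℂ) + α * I)
        (((κ * (SignType.sign α : ℝ) : ℝ) : ℂ) + 1 * I) α :=
      ((hasDerivAt_abs hα).const_mul κ).ofReal_comp.add
        ((hasDerivAt_id α).ofReal_comp.mul_const I)
    refine (((hΨ _).comp_of_eq α hlog rfl).div_const (2 * π * I)).congr_deriv ?_
    simp only [spiralWeight]
    field_simp
    ring_nf
    simp
  rw [integral_eq_of_hasDerivAt_off_countable _ _ (countable_singleton 0) ?_ hderiv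
    ((intervalIntegrable_spiralWeight κ _ _).mul_continuousOn (hΨ'.comp hcont).continuousOn)]
  · simp only [abs_neg, abs_of_pos pi_pos, ofReal_mul, ofReal_neg, neg_mul, ← sub_eq_add_neg,
      sub_div]
  · have hΨc : Continuous Ψ := continuous_iff_continuousAt.2 fun t ↦ (hΨ t).continuousAt
    exact ((hΨc.comp hcont).div_const _).continuousOn

lemma spiralMean_zpow (m : ℤ) : spiralMean κ (fun w ↦ w ^ m) = if m = 0 then 1 else 0 := by
  rcases eq_or_ne m 0 with rfl | hm
  · have h := integral_spiralWeight_mul_deriv (κ := κ) (fun t ↦ hasDerivAt_id' t) continuous_const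
    simp only [spiralMean, zpow_zero, h, if_true]
    field_simp
    ring
  · have hderiv : ∀ t, HasDerivAt (fun t : ℂ ↦ cexp (m * t) / m) (cexp (m * t)) t := fun t ↦ by
      have := (((hasDerivAt_id' t).const_mul (m : ℂ)).cexp).div_const (m : ℂ)
      simpa [hm] using this
    have h := integral_spiralWeight_mul_deriv (κ := κ) hderiv (by fun_prop)
    have hperiod : cexp (m * (κ * π + π * I)) = cexp (m * (κ * π - π * I)) :=
      Complex.exp_eq_exp_iff_exists_int.2 ⟨m, by ring⟩
    simp only [spiralMean, spiralCurve, ← Complex.exp_int_mul, h, hperiod, sub_self, zero_div, hm,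
      if_false]

lemma continuousOn_comp_spiralCurve (hΦ : ContinuousOn Φ {w | spiralGauge κ w = 1}) :
    ContinuousOn (fun α ↦ Φ (spiralCurve κ α)) [[-π, π]] :=
  hΦ.comp continuous_spiralCurve.continuousOn fun _ hα ↦
    spiralGauge_spiralCurve (abs_le_pi_of_mem_uIcc hα)

lemma differentiableOn_spiralMean {Ω V : Set ℂ} (hc : ContinuousOn c {w | spiralGauge κ w = 1})
    (hu : ContinuousOn u {w | spiralGauge κ w = 1}) (hΩ : IsOpen Ω) (hG : DifferentiableOn ℂ G Ω)
    (hV : IsOpen V) (hVΩ : ∀ z ∈ V, ∀ w, spiralGauge κ w = 1 → z * u w ∈ Ω) :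
    DifferentiableOn ℂ (fun z ↦ spiralMean κ fun w ↦ c w * G (z * u w)) V := by
  simpa only [spiralMean, mul_assoc] using differentiableOn_intervalIntegral_mul
    ((intervalIntegrable_spiralWeight κ _ _).mul_continuousOn (continuousOn_comp_spiralCurve hc))
    (continuousOn_comp_spiralCurve hu) hΩ hG hV fun z hz _ hα ↦
      hVΩ z hz _ (spiralGauge_spiralCurve (abs_le_pi_of_mem_uIcc hα))

lemma hasFPowerSeriesAt_spiralMean (hc : ContinuousOn c {w | spiralGauge κ w = 1})
    (hu : ContinuousOn u {w | spiralGauge κ w = 1}) (hG : HasFPowerSeriesAt G (toFormal g) 0) :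
    HasFPowerSeriesAt (fun z ↦ spiralMean κ fun w ↦ c w * G (z * u w))
      (toFormal (PowerSeries.mk fun n ↦
        PowerSeries.coeff n g * spiralMean κ fun w ↦ c w * u w ^ n)) 0 := by
  simpa only [spiralMean, mul_assoc] using hasFPowerSeriesAt_intervalIntegral_mul
    ((intervalIntegrable_spiralWeight κ _ _).mul_continuousOn (continuousOn_comp_spiralCurve hc))
    (continuousOn_comp_spiralCurve hu) hG

end SpiralMean

/-- The Hadamard convolution `(2πi)⁻¹ ∮ F(v) G(z / v) dv / v` over the closed curve
`ρ * spiralCurve κ`. -/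
noncomputable def spiralHadamard (κ ρ : ℝ) (F G : ℂ → ℂ) (z : ℂ) : ℂ :=
  spiralMean κ fun w ↦ F (ρ * w) * G (z * (ρ * w)⁻¹)

/-- The Hadamard convolution of `F` and `G`, as a function on `spiralDomain κ 1`. The contour
moves with `z`; every curve `ρ * spiralCurve κ` with `spiralGauge κ z < ρ < 1` gives the same
value. -/
noncomputable def spiralContinuation (κ : ℝ) (F G : ℂ → ℂ) (z : ℂ) : ℂ :=
  spiralHadamard κ ((1 + spiralGauge κ z) / 2) F G z

section Hadamard

variable {κ ρ ρ' : ℝ} {F G : ℂ → ℂ} {f g : PowerSeries ℂ}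

lemma spiralMean_inv_pow_mul (hκ : 0 ≤ κ) (hF : HasFPowerSeriesAt F (toFormal f) 0)
    (hFan : DifferentiableOn ℂ F (spiralDomain κ 1)) {s : ℂ} (hs : s ∈ spiralDomain (-κ) 1)
    (n : ℕ) : spiralMean κ (fun w ↦ (w ^ n)⁻¹ * F (s * w)) = PowerSeries.coeff n f * s ^ n := by
  have hne : ∀ w ∈ {w | spiralGauge κ w = 1}, w ≠ 0 := by
    rintro w hw rfl
    simp at hw
  have hinv : ContinuousOn (fun w : ℂ ↦ (w ^ n)⁻¹) {w | spiralGauge κ w = 1} :=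
    (continuous_pow n).continuousOn.inv₀ fun w hw ↦ pow_ne_zero n (hne w hw)
  have hdiff : DifferentiableOn ℂ (fun s ↦ spiralMean κ fun w ↦ (w ^ n)⁻¹ * F (s * w))
      (spiralDomain (-κ) 1) :=
    differentiableOn_spiralMean hinv continuousOn_id isOpen_spiralDomain hFan isOpen_spiralDomain
      fun s hs w hw ↦ by
        have h := spiralGauge_mul_le hκ w s
        rw [hw, one_mul, mul_comm] at h
        exact h.trans_lt hs
  have horth (k : ℕ) : spiralMean κ (fun w ↦ (w ^ n)⁻¹ * w ^ k) = if k = n then 1 else 0 := by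
    rw [spiralMean_congr (Ψ := fun w ↦ w ^ (k - n : ℤ)), spiralMean_zpow]
    · simp [sub_eq_zero]
    · intro w hw
      simp [zpow_sub₀ (hne w hw), div_eq_inv_mul]
  have hnear : (fun s ↦ spiralMean κ fun w ↦ (w ^ n)⁻¹ * F (s * w)) =ᶠ[𝓝 0]
      fun s ↦ PowerSeries.coeff n f * s ^ n := by
    filter_upwards [hasFPowerSeriesAt_toFormal_iff.1
      (hasFPowerSeriesAt_spiralMean hinv continuousOn_id hF)] with s hs
    refine hs.unique ?_
    convert hasSum_single n fun k hk ↦ ?_ using 1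
    · simp [horth]
    · simp [horth, hk]
  exact (hdiff.analyticOnNhd isOpen_spiralDomain).eqOn_of_preconnected_of_eventuallyEq
    (fun _ _ ↦ by fun_prop) isPreconnected_spiralDomain (zero_mem_spiralDomain one_pos) hnear hs

lemma ofReal_mem_spiralDomain_iff (hρ : 0 ≤ ρ) : (ρ : ℂ) ∈ spiralDomain κ ρ' ↔ ρ < ρ' := by
  simp [spiralDomain, spiralGauge, arg_ofReal_of_nonneg hρ, abs_of_nonneg hρ]

lemma continuousOn_comp_ofReal_mul (hρ₀ : 0 ≤ ρ) (hρ₁ : ρ < 1)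
    (hFan : DifferentiableOn ℂ F (spiralDomain κ 1)) :
    ContinuousOn (fun w ↦ F (ρ * w)) {w | spiralGauge κ w = 1} :=
  hFan.continuousOn.comp (by fun_prop) fun w (hw : spiralGauge κ w = 1) ↦ by
    simpa [spiralDomain, spiralGauge_ofReal_mul hρ₀, hw] using hρ₁

lemma continuousOn_inv_ofReal_mul (hρ₀ : 0 < ρ) :
    ContinuousOn (fun w : ℂ ↦ (ρ * w)⁻¹) {w | spiralGauge κ w = 1} := by
  refine ContinuousOn.inv₀ (by fun_prop) fun w hw ↦ mul_ne_zero (ofReal_ne_zero.2 hρ₀.ne') ?_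
  rintro rfl
  simp at hw

lemma hasFPowerSeriesAt_spiralHadamard (hκ : 0 ≤ κ) (hρ₀ : 0 < ρ) (hρ₁ : ρ < 1)
    (hF : HasFPowerSeriesAt F (toFormal f) 0) (hG : HasFPowerSeriesAt G (toFormal g) 0)
    (hFan : DifferentiableOn ℂ F (spiralDomain κ 1)) :
    HasFPowerSeriesAt (spiralHadamard κ ρ F G) (toFormal (hadamardProduct f g)) 0 := by
  have hcoeff (n : ℕ) :
      spiralMean κ (fun w ↦ F (ρ * w) * (ρ * w)⁻¹ ^ n) = PowerSeries.coeff n f := by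
    have hpow : (ρ : ℂ) ^ n ≠ 0 := pow_ne_zero n (ofReal_ne_zero.2 hρ₀.ne')
    calc spiralMean κ (fun w ↦ F (ρ * w) * (ρ * w)⁻¹ ^ n)
        = spiralMean κ (fun w ↦ ((ρ : ℂ) ^ n)⁻¹ * ((w ^ n)⁻¹ * F (ρ * w))) := by
          congr with w
          rw [inv_pow, mul_pow, mul_inv, mul_comm, mul_assoc]
      _ = ((ρ : ℂ) ^ n)⁻¹ * (PowerSeries.coeff n f * ρ ^ n) := by
          rw [spiralMean_const_mul, spiralMean_inv_pow_mul hκ hF hFan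
            ((ofReal_mem_spiralDomain_iff hρ₀.le).2 hρ₁)]
      _ = PowerSeries.coeff n f := by field_simp
  have hprod : hadamardProduct f g = PowerSeries.mk fun n ↦
      PowerSeries.coeff n g * spiralMean κ fun w ↦ F (ρ * w) * (ρ * w)⁻¹ ^ n := by
    ext n
    simp only [hadamardProduct, PowerSeries.coeff_mk, hcoeff, mul_comm (PowerSeries.coeff n f)]
  rw [hprod]
  exact hasFPowerSeriesAt_spiralMean (continuousOn_comp_ofReal_mul hρ₀.le hρ₁ hFan)
    (continuousOn_inv_ofReal_mul hρ₀) hG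

lemma differentiableOn_spiralHadamard (hκ : 0 ≤ κ) (hρ₀ : 0 < ρ) (hρ₁ : ρ < 1)
    (hFan : DifferentiableOn ℂ F (spiralDomain κ 1))
    (hGan : DifferentiableOn ℂ G (spiralDomain κ 1)) :
    DifferentiableOn ℂ (spiralHadamard κ ρ F G) (spiralDomain κ ρ) :=
  differentiableOn_spiralMean (continuousOn_comp_ofReal_mul hρ₀.le hρ₁ hFan)
    (continuousOn_inv_ofReal_mul hρ₀) isOpen_spiralDomain hGan isOpen_spiralDomain
    fun z hz w hw ↦ by
      refine (spiralGauge_mul_inv_le hκ z _).trans_lt ?_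
      rwa [spiralGauge_ofReal_mul hρ₀.le, hw, mul_one, div_lt_one hρ₀]

lemma spiralHadamard_eqOn (hκ : 0 ≤ κ) (hρ₀ : 0 < ρ) (hρρ' : ρ ≤ ρ') (hρ' : ρ' < 1)
    (hF : HasFPowerSeriesAt F (toFormal f) 0) (hG : HasFPowerSeriesAt G (toFormal g) 0)
    (hFan : DifferentiableOn ℂ F (spiralDomain κ 1))
    (hGan : DifferentiableOn ℂ G (spiralDomain κ 1)) :
    EqOn (spiralHadamard κ ρ F G) (spiralHadamard κ ρ' F G) (spiralDomain κ ρ) := by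
  have hρ : ρ < 1 := hρρ'.trans_lt hρ'
  have hρ'₀ : 0 < ρ' := hρ₀.trans_le hρρ'
  have hnear : spiralHadamard κ ρ F G =ᶠ[𝓝 0] spiralHadamard κ ρ' F G := by
    filter_upwards [hasFPowerSeriesAt_toFormal_iff.1
        (hasFPowerSeriesAt_spiralHadamard hκ hρ₀ hρ hF hG hFan),
      hasFPowerSeriesAt_toFormal_iff.1
        (hasFPowerSeriesAt_spiralHadamard hκ hρ'₀ hρ' hF hG hFan)] with z h h' using h.unique h'
  exact ((differentiableOn_spiralHadamard hκ hρ₀ hρ hFan hGan).analyticOnNhd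
      isOpen_spiralDomain).eqOn_of_preconnected_of_eventuallyEq
    (((differentiableOn_spiralHadamard hκ hρ'₀ hρ' hFan hGan).mono
      (spiralDomain_subset le_rfl hρρ')).analyticOnNhd isOpen_spiralDomain)
    isPreconnected_spiralDomain (zero_mem_spiralDomain hρ₀) hnear

lemma spiralContinuation_eqOn (hκ : 0 ≤ κ) (hρ₀ : 0 < ρ) (hρ₁ : ρ < 1)
    (hF : HasFPowerSeriesAt F (toFormal f) 0) (hG : HasFPowerSeriesAt G (toFormal g) 0)
    (hFan : DifferentiableOn ℂ F (spiralDomain κ 1))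
    (hGan : DifferentiableOn ℂ G (spiralDomain κ 1)) :
    EqOn (spiralContinuation κ F G) (spiralHadamard κ ρ F G) (spiralDomain κ ρ) := by
  intro z (hz : spiralGauge κ z < ρ)
  have hz₀ : 0 ≤ spiralGauge κ z := spiralGauge_nonneg
  rcases le_total ((1 + spiralGauge κ z) / 2) ρ with h | h
  · exact spiralHadamard_eqOn hκ (by positivity) h hρ₁ hF hG hFan hGan
      (show spiralGauge κ z < (1 + spiralGauge κ z) / 2 by linarith)
  · exact (spiralHadamard_eqOn hκ hρ₀ h (by linarith) hF hG hFan hGan hz).symm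

lemma hasFPowerSeriesAt_spiralContinuation (hκ : 0 ≤ κ)
    (hF : HasFPowerSeriesAt F (toFormal f) 0) (hG : HasFPowerSeriesAt G (toFormal g) 0)
    (hFan : DifferentiableOn ℂ F (spiralDomain κ 1))
    (hGan : DifferentiableOn ℂ G (spiralDomain κ 1)) :
    HasFPowerSeriesAt (spiralContinuation κ F G) (toFormal (hadamardProduct f g)) 0 :=
  (hasFPowerSeriesAt_spiralHadamard hκ one_half_pos one_half_lt_one hF hG hFan).congr
    ((spiralContinuation_eqOn hκ one_half_pos one_half_lt_one hF hG hFan hGan).eventuallyEq_of_mem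
      (isOpen_spiralDomain.mem_nhds (zero_mem_spiralDomain one_half_pos))).symm

lemma analyticOnNhd_spiralContinuation (hκ : 0 ≤ κ)
    (hF : HasFPowerSeriesAt F (toFormal f) 0) (hG : HasFPowerSeriesAt G (toFormal g) 0)
    (hFan : DifferentiableOn ℂ F (spiralDomain κ 1))
    (hGan : DifferentiableOn ℂ G (spiralDomain κ 1)) :
    AnalyticOnNhd ℂ (spiralContinuation κ F G) (spiralDomain κ 1) := by
  intro z hz
  obtain ⟨ρ, hzρ, hρ₁⟩ := exists_between (show spiralGauge κ z < 1 from hz)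
  have hρ₀ : 0 < ρ := spiralGauge_nonneg.trans_lt hzρ
  have hanalytic := (differentiableOn_spiralHadamard hκ hρ₀ hρ₁ hFan hGan).analyticOnNhd
    isOpen_spiralDomain z hzρ
  exact hanalytic.congr ((spiralContinuation_eqOn hκ hρ₀ hρ₁ hF hG hFan hGan).eventuallyEq_of_mem
    (isOpen_spiralDomain.mem_nhds hzρ)).symm

end Hadamard

/-- The point of parameter `α` on the curve `ρ * spiralCurve κ`, where the scale
`ρ = 1 - c * ‖1 - z‖` makes the distance from `1` to the curve comparable to `‖1 - z‖`. -/
noncomputable def contourPoint (κ c : ℝ) (z : ℂ) (α : ℝ) : ℂ :=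
  (1 - c * ‖1 - z‖ : ℝ) * spiralCurve κ α

section Asymptotics

open MeasureTheory

variable {κ κ' a b c p r α : ℝ} {z : ℂ} {T : Set ℂ} {F G Φ : ℂ → ℂ} {f g : PowerSeries ℂ}

lemma half_le_one_sub_mul_norm_of_spiralGauge_le (hz : spiralGauge κ z ≤ 1 - 2 * c * ‖1 - z‖) :
    1 / 2 ≤ 1 - c * ‖1 - z‖ := by
  linarith [spiralGauge_nonneg.trans hz]

lemma abs_arg_contourPoint (hz : spiralGauge κ z ≤ 1 - 2 * c * ‖1 - z‖) (hα : |α| ≤ π) :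
    |(contourPoint κ c z α).arg| = |α| := by
  have hρ := half_le_one_sub_mul_norm_of_spiralGauge_le hz
  rw [contourPoint, arg_real_mul _ (by linarith), abs_arg_spiralCurve hα]

lemma spiralGauge_contourPoint (hz : spiralGauge κ z ≤ 1 - 2 * c * ‖1 - z‖) (hα : |α| ≤ π) :
    spiralGauge κ (contourPoint κ c z α) = 1 - c * ‖1 - z‖ := by
  have hρ := half_le_one_sub_mul_norm_of_spiralGauge_le hz
  rw [contourPoint, spiralGauge_ofReal_mul (by linarith), spiralGauge_spiralCurve hα, mul_one]

lemma spiralGauge_mul_inv_contourPoint_le (hκ : 0 ≤ κ)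
    (hz : spiralGauge κ z ≤ 1 - 2 * c * ‖1 - z‖) (hα : |α| ≤ π) :
    spiralGauge κ (z * (contourPoint κ c z α)⁻¹) ≤ 1 - c * ‖1 - z‖ := by
  have hρ := half_le_one_sub_mul_norm_of_spiralGauge_le hz
  refine (spiralGauge_mul_inv_le hκ _ _).trans ?_
  rw [spiralGauge_contourPoint hz hα, div_le_iff₀ (by linarith)]
  nlinarith [sq_nonneg (c * ‖1 - z‖)]

lemma contourPoint_ne_zero (hz : spiralGauge κ z ≤ 1 - 2 * c * ‖1 - z‖) :
    contourPoint κ c z α ≠ 0 :=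
  mul_ne_zero (ofReal_ne_zero.2 (by linarith [half_le_one_sub_mul_norm_of_spiralGauge_le hz]))
    (spiralCurve_ne_zero α)

lemma norm_one_sub_contourPoint_le (hκ : 0 ≤ κ) (hc : 0 ≤ c)
    (hz : spiralGauge κ z ≤ 1 - 2 * c * ‖1 - z‖) (hα : |α| ≤ π) :
    ‖1 - contourPoint κ c z α‖ ≤ (c + (1 + κ) * Real.exp (κ * π)) * (‖1 - z‖ + |α|) := by
  have hρ := half_le_one_sub_mul_norm_of_spiralGauge_le hz
  set C := (1 + κ) * Real.exp (κ * π)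
  have hC : 0 ≤ C := by positivity
  have hcr : 0 ≤ c * ‖1 - z‖ := by positivity
  calc ‖1 - contourPoint κ c z α‖
      ≤ (1 - (1 - c * ‖1 - z‖)) + (1 - c * ‖1 - z‖) * (C * |α|) :=
        norm_one_sub_ofReal_mul_spiralCurve_le hκ (by linarith) (by linarith) hα
    _ ≤ c * ‖1 - z‖ + C * |α| := by
        linarith [mul_nonneg hcr (mul_nonneg hC (abs_nonneg α))]
    _ ≤ (c + C) * (‖1 - z‖ + |α|) := by
        linarith [mul_nonneg hc (abs_nonneg α), mul_nonneg hC (norm_nonneg (1 - z))]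

lemma norm_one_sub_mul_inv_contourPoint_le (hκ : 0 ≤ κ)
    (hz : spiralGauge κ z ≤ 1 - 2 * c * ‖1 - z‖) (hα : |α| ≤ π) :
    ‖1 - z * (contourPoint κ c z α)⁻¹‖ ≤ 2 * (‖1 - z‖ + ‖1 - contourPoint κ c z α‖) := by
  have hne := contourPoint_ne_zero (α := α) hz
  have hgauge := spiralGauge_contourPoint hz hα
  set v := contourPoint κ c z α
  have hv : 1 / 2 ≤ ‖v‖ :=
    calc 1 / 2 ≤ spiralGauge κ v := hgauge ▸ half_le_one_sub_mul_norm_of_spiralGauge_le hz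
      _ ≤ spiralGauge 0 v := spiralGauge_le_of_le hκ
      _ = ‖v‖ := by simp [spiralGauge]
  have htriangle : ‖v‖ * ‖1 - z * v⁻¹‖ ≤ ‖1 - z‖ + ‖1 - v‖ := by
    rw [← norm_mul, mul_sub, mul_one, mul_left_comm, mul_inv_cancel₀ hne, mul_one,
      ← sub_sub_sub_cancel_left z v 1]
    exact norm_sub_le _ _
  linarith [mul_le_mul_of_nonneg_right hv (norm_nonneg (1 - z * v⁻¹))]

lemma abs_le_pi_mul_norm_one_sub_add_abs_arg (hz : spiralGauge κ z ≤ 1 - 2 * c * ‖1 - z‖)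
    (hα : |α| ≤ π) : |α| ≤ π * ‖1 - z‖ + |(z * (contourPoint κ c z α)⁻¹).arg| := by
  rcases eq_or_ne z 0 with rfl | hz₀
  · simpa using hα
  calc |α| = |(z * (z * (contourPoint κ c z α)⁻¹)⁻¹).arg| := by
        rw [mul_inv, inv_inv, mul_inv_cancel_left₀ hz₀, abs_arg_contourPoint hz hα]
    _ ≤ |z.arg| + |(z * (contourPoint κ c z α)⁻¹).arg| := by
        simpa only [abs_arg_inv] using abs_arg_mul_le z (z * (contourPoint κ c z α)⁻¹)⁻¹
    _ ≤ π * ‖1 - z‖ + |(z * (contourPoint κ c z α)⁻¹).arg| := by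
        gcongr
        exact abs_arg_le_pi_mul_norm_one_sub z

lemma add_le_one_div_add_one_mul {s : ℝ} (hc : 0 < c) (hr : 0 ≤ r) (hs : 0 ≤ s) :
    r + s ≤ (1 / c + 1) * (c * r + s) := by
  have h : (1 / c + 1) * (c * r + s) = r + s + (s / c + c * r) := by
    field_simp
    ring
  rw [h]
  exact le_add_of_nonneg_right (by positivity)

lemma isTheta_norm_one_sub_contourPoint (hκ : 0 ≤ κ) (hc : 0 < c)
    (hT : ∀ z ∈ T, spiralGauge κ z ≤ 1 - 2 * c * ‖1 - z‖) :
    (fun q : ℂ × ℝ ↦ ‖1 - contourPoint κ c q.1 q.2‖) =Θ[𝓟 (T ×ˢ {α | |α| ≤ π})]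
      fun q ↦ ‖1 - q.1‖ + |q.2| := by
  refine ⟨.of_bound (c + (1 + κ) * Real.exp (κ * π)) (eventually_principal.2 ?_),
    .of_bound ((1 / c + 1) * (1 + κ * π + π)) (eventually_principal.2 ?_)⟩
  · rintro ⟨z, α⟩ ⟨hz, hα⟩
    rw [norm_norm, Real.norm_of_nonneg (by positivity)]
    exact norm_one_sub_contourPoint_le hκ hc.le (hT z hz) hα
  · rintro ⟨z, α⟩ ⟨hz, hα⟩
    have hlower := add_abs_arg_le_of_spiralGauge_le_one_sub hκ
      (spiralGauge_contourPoint (hT z hz) hα).le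
    rw [abs_arg_contourPoint (hT z hz) hα] at hlower
    rw [norm_norm, Real.norm_of_nonneg (by positivity), mul_assoc]
    exact (add_le_one_div_add_one_mul hc (norm_nonneg _) (abs_nonneg _)).trans (by gcongr)

lemma isTheta_norm_one_sub_mul_inv_contourPoint (hκ : 0 ≤ κ) (hc : 0 < c)
    (hT : ∀ z ∈ T, spiralGauge κ z ≤ 1 - 2 * c * ‖1 - z‖) :
    (fun q : ℂ × ℝ ↦ ‖1 - q.1 * (contourPoint κ c q.1 q.2)⁻¹‖) =Θ[𝓟 (T ×ˢ {α | |α| ≤ π})]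
      fun q ↦ ‖1 - q.1‖ + |q.2| := by
  constructor
  · have hle : (fun q : ℂ × ℝ ↦ ‖1 - q.1 * (contourPoint κ c q.1 q.2)⁻¹‖)
        =O[𝓟 (T ×ˢ {α | |α| ≤ π})] fun q ↦ ‖1 - q.1‖ + ‖1 - contourPoint κ c q.1 q.2‖ := by
      refine .of_bound 2 (eventually_principal.2 ?_)
      rintro ⟨z, α⟩ ⟨hz, hα⟩
      rw [norm_norm, Real.norm_of_nonneg (by positivity)]
      exact norm_one_sub_mul_inv_contourPoint_le hκ (hT z hz) hα
    have hnorm : (fun q : ℂ × ℝ ↦ ‖1 - q.1‖) =O[𝓟 (T ×ˢ {α | |α| ≤ π})]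
        fun q ↦ ‖1 - q.1‖ + |q.2| := .of_norm_le fun q ↦ by simp
    exact hle.trans (hnorm.add (isTheta_norm_one_sub_contourPoint hκ hc hT).isBigO)
  · refine .of_bound ((1 / (c / (1 + π)) + 1) * (1 + κ * π + π)) (eventually_principal.2 ?_)
    rintro ⟨z, α⟩ ⟨hz, hα⟩
    have hlower := add_abs_arg_le_of_spiralGauge_le_one_sub hκ
      (spiralGauge_mul_inv_contourPoint_le hκ (hT z hz) hα)
    have harg := abs_le_pi_mul_norm_one_sub_add_abs_arg (hT z hz) hα
    rw [norm_norm, Real.norm_of_nonneg (by positivity), mul_assoc]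
    calc ‖1 - z‖ + |α| ≤ (1 + π) * ‖1 - z‖ + |(z * (contourPoint κ c z α)⁻¹).arg| := by
          linarith
      _ ≤ (1 / (c / (1 + π)) + 1) * (c / (1 + π) * ((1 + π) * ‖1 - z‖) +
          |(z * (contourPoint κ c z α)⁻¹).arg|) :=
          add_le_one_div_add_one_mul (by positivity) (by positivity) (abs_nonneg _)
      _ ≤ _ := by
          rw [← mul_assoc (c / (1 + π)), div_mul_cancel₀ _ (by positivity)]
          gcongr

lemma integral_add_abs_rpow_le (hr : 0 < r) (hp : p + 1 < 0) :
    ∫ α in -π..π, (r + |α|) ^ p ≤ 2 * (r ^ (p + 1) / -(p + 1)) := by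
  have hcont : Continuous fun α : ℝ ↦ (r + |α|) ^ p :=
    (by fun_prop : Continuous fun α : ℝ ↦ r + |α|).rpow_const fun α ↦ .inl (by positivity)
  have hright : ∫ α in 0..π, (r + |α|) ^ p ≤ r ^ (p + 1) / -(p + 1) := by
    calc ∫ α in 0..π, (r + |α|) ^ p = ∫ α in 0..π, (r + α) ^ p :=
          intervalIntegral.integral_congr fun α hα ↦ by
            rw [uIcc_of_le pi_pos.le] at hα
            simp only [abs_of_nonneg hα.1]
      _ = ((r + π) ^ (p + 1) - r ^ (p + 1)) / (p + 1) := by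
          rw [intervalIntegral.integral_comp_add_left (fun x ↦ x ^ p) r, add_zero,
            integral_rpow (.inr ⟨by linarith, notMem_uIcc_of_lt hr (by positivity)⟩)]
      _ ≤ r ^ (p + 1) / -(p + 1) := by
          rw [div_neg, ← neg_div, div_le_div_right_of_neg hp]
          linarith [rpow_nonneg (by positivity : 0 ≤ r + π) (p + 1)]
  have hleft : ∫ α in -π..0, (r + |α|) ^ p = ∫ α in 0..π, (r + |α|) ^ p := by
    simpa using intervalIntegral.integral_comp_neg (a := -π) (b := 0) fun α ↦ (r + |α|) ^ p
  rw [← intervalIntegral.integral_add_adjacent_intervals (hcont.intervalIntegrable _ 0)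
    (hcont.intervalIntegrable _ _), hleft, ← two_mul]
  gcongr

lemma norm_spiralMean_le (hκ : 0 ≤ κ) (hr : 0 < r) (hp : p + 1 < 0) {M : ℝ} (hM : 0 ≤ M)
    (hΦ : ∀ α, |α| ≤ π → ‖Φ (spiralCurve κ α)‖ ≤ M * (r + |α|) ^ p) :
    ‖spiralMean κ Φ‖ ≤ (1 + κ) / (2 * π) * M * (2 * (r ^ (p + 1) / -(p + 1))) := by
  have hcont : Continuous fun α : ℝ ↦ (r + |α|) ^ p :=
    (by fun_prop : Continuous fun α : ℝ ↦ r + |α|).rpow_const fun α ↦ .inl (by positivity)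
  calc ‖spiralMean κ Φ‖ ≤ ∫ α in -π..π, (1 + κ) / (2 * π) * M * (r + |α|) ^ p := by
        refine intervalIntegral.norm_integral_le_of_norm_le (by linarith [pi_pos])
          (ae_of_all _ fun α hα ↦ ?_) ((hcont.const_mul _).intervalIntegrable _ _)
        rw [norm_mul, mul_assoc _ M]
        exact mul_le_mul (norm_spiralWeight_le hκ α) (hΦ α (abs_le.2 ⟨hα.1.le, hα.2⟩))
          (norm_nonneg _) (by positivity)
    _ ≤ (1 + κ) / (2 * π) * M * (2 * (r ^ (p + 1) / -(p + 1))) := by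
        rw [intervalIntegral.integral_const_mul]
        gcongr
        exact integral_add_abs_rpow_le hr hp

lemma isBigO_mul_contourPoint (hκ : 0 ≤ κ) (hc : 0 < c) (hT₁ : (1 : ℂ) ∉ T)
    (hT : ∀ z ∈ T, spiralGauge κ z ≤ 1 - 2 * c * ‖1 - z‖)
    (hF : F =O[𝓟 (spiralDomain κ 1)] fun z ↦ ‖1 - z‖ ^ a)
    (hG : G =O[𝓟 (spiralDomain κ 1)] fun z ↦ ‖1 - z‖ ^ b) :
    (fun q : ℂ × ℝ ↦ F (contourPoint κ c q.1 q.2) * G (q.1 * (contourPoint κ c q.1 q.2)⁻¹))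
      =O[𝓟 (T ×ˢ {α | |α| ≤ π})] fun q ↦ (‖1 - q.1‖ + |q.2|) ^ (a + b) := by
  have hpos : ∀ z ∈ T, 0 < ‖1 - z‖ := fun z hz ↦
    norm_pos_iff.2 (sub_ne_zero.2 (ne_of_mem_of_not_mem hz hT₁).symm)
  have hFv : Tendsto (fun q : ℂ × ℝ ↦ contourPoint κ c q.1 q.2) (𝓟 (T ×ˢ {α | |α| ≤ π}))
      (𝓟 (spiralDomain κ 1)) := tendsto_principal_principal.2 fun q ⟨hz, hα⟩ ↦ by
    have := mul_pos hc (hpos _ hz)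
    exact (spiralGauge_contourPoint (hT _ hz) hα).trans_lt (by linarith)
  have hGv : Tendsto (fun q : ℂ × ℝ ↦ q.1 * (contourPoint κ c q.1 q.2)⁻¹)
      (𝓟 (T ×ˢ {α | |α| ≤ π})) (𝓟 (spiralDomain κ 1)) :=
    tendsto_principal_principal.2 fun q ⟨hz, hα⟩ ↦ by
      have := mul_pos hc (hpos _ hz)
      exact (spiralGauge_mul_inv_contourPoint_le hκ (hT _ hz) hα).trans_lt (by linarith)
  have hsplit : (fun q : ℂ × ℝ ↦ (‖1 - q.1‖ + |q.2|) ^ (a + b)) =ᶠ[𝓟 (T ×ˢ {α | |α| ≤ π})]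
      fun q ↦ (‖1 - q.1‖ + |q.2|) ^ a * (‖1 - q.1‖ + |q.2|) ^ b :=
    eventually_principal.2 fun q ⟨hz, _⟩ ↦
      rpow_add (add_pos_of_pos_of_nonneg (hpos _ hz) (abs_nonneg _)) a b
  have hnonneg : 0 ≤ᶠ[𝓟 (T ×ˢ {α : ℝ | |α| ≤ π})] fun q ↦ ‖1 - q.1‖ + |q.2| :=
    .of_forall fun q ↦ by positivity
  refine (IsBigO.mul ?_ ?_).trans_eventuallyEq hsplit.symm
  · exact (hF.comp_tendsto hFv).trans ((isTheta_norm_one_sub_contourPoint hκ hc hT).rpow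
      (.of_forall fun _ ↦ norm_nonneg _) hnonneg).isBigO
  · exact (hG.comp_tendsto hGv).trans ((isTheta_norm_one_sub_mul_inv_contourPoint hκ hc hT).rpow
      (.of_forall fun _ ↦ norm_nonneg _) hnonneg).isBigO

theorem isBigO_spiralContinuation (hκ' : 0 ≤ κ') (hκ : κ' < κ) (hab : a + b + 1 < 0)
    (hFf : HasFPowerSeriesAt F (toFormal f) 0) (hGg : HasFPowerSeriesAt G (toFormal g) 0)
    (hFan : DifferentiableOn ℂ F (spiralDomain κ 1))
    (hGan : DifferentiableOn ℂ G (spiralDomain κ 1))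
    (hF : F =O[𝓟 (spiralDomain κ 1)] fun z ↦ ‖1 - z‖ ^ a)
    (hG : G =O[𝓟 (spiralDomain κ 1)] fun z ↦ ‖1 - z‖ ^ b) :
    spiralContinuation κ F G =O[𝓟 (spiralDomain κ' 1)] fun z ↦ ‖1 - z‖ ^ (a + b + 1) := by
  have hκ₀ : 0 ≤ κ := hκ'.trans hκ.le
  have hone : (1 : ℂ) ∉ spiralDomain κ' 1 := by simp [spiralDomain]
  obtain ⟨c, hc, hgap⟩ : ∃ c > 0, ∀ z ∈ spiralDomain κ' 1,
      spiralGauge κ z ≤ 1 - 2 * c * ‖1 - z‖ := by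
    obtain ⟨c, hc, hgap⟩ := exists_spiralGauge_le_one_sub hκ' hκ
    exact ⟨c / 2, by positivity, by simpa [mul_div_cancel₀] using hgap⟩
  obtain ⟨M, hM, hbound⟩ := (isBigO_mul_contourPoint hκ₀ hc hone hgap hF hG).exists_nonneg
  rw [isBigOWith_principal] at hbound
  refine .of_bound ((1 + κ) / (2 * π) * M * (2 / -(a + b + 1))) (eventually_principal.2 ?_)
  intro z hz
  have hr : 0 < ‖1 - z‖ := norm_pos_iff.2 (sub_ne_zero.2 (ne_of_mem_of_not_mem hz hone).symm)
  have hρ := half_le_one_sub_mul_norm_of_spiralGauge_le (hgap z hz)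
  have hcr := mul_pos hc hr
  rw [spiralContinuation_eqOn hκ₀ (by linarith) (by linarith) hFf hGg hFan hGan
    (show z ∈ spiralDomain κ (1 - c * ‖1 - z‖) from (hgap z hz).trans_lt (by linarith))]
  calc ‖spiralHadamard κ (1 - c * ‖1 - z‖) F G z‖
      ≤ (1 + κ) / (2 * π) * M * (2 * (‖1 - z‖ ^ (a + b + 1) / -(a + b + 1))) := by
        refine norm_spiralMean_le hκ₀ hr hab hM fun α hα ↦ ?_
        have h := hbound (z, α) ⟨hz, hα⟩
        rwa [Real.norm_of_nonneg (rpow_nonneg (by positivity) _)] at h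
    _ = (1 + κ) / (2 * π) * M * (2 / -(a + b + 1)) * ‖‖1 - z‖ ^ (a + b + 1)‖ := by
        rw [Real.norm_of_nonneg (by positivity)]
        ring

end Asymptotics

end Spiral

theorem mainTheorem2
    (ψ₀ η : ℝ) (hψ₀ : 0 < ψ₀) (hψ₀' : ψ₀ < Real.pi / 2) (hη : 0 < η)
    (a b : ℝ) (hab : a + b + 1 < 0)
    (f g : PowerSeries ℂ) (F G : ℂ → ℂ)
    (hf : IsDeltaRegular f F ψ₀ η) (hg : IsDeltaRegular g G ψ₀ η)
    (hF : F =O[𝓟 (deltaDomain ψ₀ η)] fun z : ℂ => ‖1 - z‖ ^ a)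
    (hG : G =O[𝓟 (deltaDomain ψ₀ η)] fun z : ℂ => ‖1 - z‖ ^ b) :
    ∃ ψ₁ η₁ : ℝ, ψ₀ ≤ ψ₁ ∧ ψ₁ < Real.pi / 2 ∧ 0 < η₁ ∧ η₁ ≤ η ∧
      ∃ H : ℂ → ℂ, IsDeltaContinuation (hadamardProduct f g) H ψ₁ η₁ ∧
        H =O[𝓟 (deltaDomain ψ₁ η₁)] fun z : ℂ => ‖1 - z‖ ^ (a + b + 1) := by
  obtain ⟨κ, hκ, hsub⟩ := exists_spiralDomain_subset_deltaDomain hψ₀.le hψ₀' hη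
  obtain ⟨ψ₁, η₁, hψ₁, hψ₁', hη₁, hη₁', hsub'⟩ :=
    exists_deltaDomain_subset_spiralDomain (half_pos hκ) hψ₀' hη
  have hFan : DifferentiableOn ℂ F (spiralDomain κ 1) := (hf.analytic.mono hsub).differentiableOn
  have hGan : DifferentiableOn ℂ G (spiralDomain κ 1) := (hg.analytic.mono hsub).differentiableOn
  refine ⟨ψ₁, η₁, hψ₁, hψ₁', hη₁, hη₁', spiralContinuation κ F G, ⟨?_, ?_⟩, ?_⟩
  · exact hasFPowerSeriesAt_spiralContinuation hκ.le hf.taylor hg.taylor hFan hGan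
  · exact (analyticOnNhd_spiralContinuation hκ.le hf.taylor hg.taylor hFan hGan).mono
      (hsub'.trans (spiralDomain_subset (half_le_self hκ.le) le_rfl))
  · exact (isBigO_spiralContinuation (half_pos hκ).le (half_lt_self hκ) hab hf.taylor hg.taylor
      hFan hGan (hF.mono (principal_mono.2 hsub)) (hG.mono (principal_mono.2 hsub))).mono
      (principal_mono.2 hsub')
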